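/- Let $r\ge 2$ be a fixed integer. For $n\ge 1$ write $[m]=\{1,\dots,m\}$, and call a partition of $[rn]$ into $r$-element subsets (called edges) an $r$-matching of $[rn]$. For an $r$-matching $M$ of $[rn]$ and $1\le k\le rn$ let $M_k$ be the set of all edges $e\in M$ that intersect both $[k]$ and $[rn]\setminus[k]$, and put $$x_k(M)=\sum_{e\in M_k}|e\cap[k]|.$$ Let $\mathbb{RM}^{(r)}(n)$ be an $r$-matching chosen uniformly at random among all $r$-matchings of $[rn]$, and let $$\overline{X^{(r)}}=\frac1{rn}\sum_{k=1}^{rn}x_k\big(\mathbb{RM}^{(r)}(n)\big).$$ Then, for every $n\ge1$, $$\mathbb{E}\,\overline{X^{(r)}}=\frac{(r-1)(rn+1)}{2(r+1)},$$ and for every function $\omega:\mathbb{N}\to\mathbb{R}$ with $\omega(n)\to\infty$ as $n\to\infty$, $$\lim_{n\to\infty}\mathbb{P}\left(\left|\overline{X^{(r)}}-\frac{(r-1)rn}{2(r+1)}\right|\le\omega(n)\sqrt n\right)=1.$$ -/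

import Mathlib

open MeasureTheory ProbabilityTheory Filter Topology

/-- An (ordered) `r`-matching of `[rn] = {1, …, rn}`: a partition of this set into `r`-element
subsets (the edges). -/
abbrev RMatching (r n : ℕ) : Type :=
  {M : Finpartition (Finset.Icc 1 (r * n)) // ∀ e ∈ M.parts, e.card = r}

/-- Every set of `r`-matchings is an event. -/
instance RMatching.instMeasurableSpace (r n : ℕ) : MeasurableSpace (RMatching r n) := ⊤

instance RMatching.instDiscreteMeasurableSpace (r n : ℕ) :
    DiscreteMeasurableSpace (RMatching r n) := ⟨fun _ => trivial⟩

/-- `M_k`: the edges of `M` that meet both `[k]` and `[rn] \ [k]`. -/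
def openEdges {r n : ℕ} (M : RMatching r n) (k : ℕ) : Finset (Finset ℕ) :=
  {e ∈ M.1.parts | (e ∩ Finset.Icc 1 k).Nonempty ∧
    (e ∩ (Finset.Icc 1 (r * n) \ Finset.Icc 1 k)).Nonempty}

/-- The `k`-th term of the sockuence: `x_k(M) = ∑_{e ∈ M_k} |e ∩ [k]|`. -/
def sockuence {r n : ℕ} (M : RMatching r n) (k : ℕ) : ℕ :=
  ∑ e ∈ openEdges M k, (e ∩ Finset.Icc 1 k).card

/-- The average of the sockuence, `(x_1(M) + ⋯ + x_{rn}(M)) / (rn)`. -/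
noncomputable def averageSockuence {r n : ℕ} (M : RMatching r n) : ℝ :=
  (∑ k ∈ Finset.Icc 1 (r * n), (sockuence M k : ℝ)) / ((r : ℝ) * n)

/-- The law of the random `r`-matching: the uniform distribution on all `r`-matchings
of `[rn]`. -/
noncomputable def randomRMatching (r n : ℕ) : Measure (RMatching r n) :=
  uniformOn (Set.univ : Set (RMatching r n))

/-! An element `x` of an edge `e` is counted in `x_k` exactly for `x ≤ k < max e`, so `e`
contributes `∑ x ∈ e, (max e - x)` to the total. The edges partition `[rn]`, so the sum of all `x`
is constant, and the deviation of the average from the claimed mean is `(1/n) ∑ (max e - μ)` over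
the edges, with `μ = meanMax r n` (`averageSockuence_sub`).

Permuting `[rn]` shows that all `r`-subsets are equally often edges, and all disjoint pairs of them
equally often pairs of edges. The mean is thus that of the maximum of a uniform `r`-subset, which is
`μ` (`sum_powersetCard_sup`). For the second moment, the products of centred maxima sum to zero over
all pairs of `r`-subsets, and a proportion of at most `r/n` of these pairs intersect. Hence the
off-diagonal terms total `O(n B²)` with `B = rn` (`sum_offDiag_le`), the average has variance
`O(n)`, and Chebyshev's inequality concludes. -/

/-! ### Transitivity of permutations on subsets -/

/-- Two equally large subsets of a finite set `S` are exchanged by a permutation supported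
on `S`. -/
theorem exists_perm_map_eq {α : Type*} [DecidableEq α] {S A B : Finset α} (hA : A ⊆ S)
    (hB : B ⊆ S) (h : A.card = B.card) :
    ∃ σ : Equiv.Perm α, (∀ x ∉ S, σ x = x) ∧ A.map σ.toEmbedding = B := by
  classical
  have e : {x : S // x.1 ∈ A} ≃ {x : S // x.1 ∈ B} := by
    refine Fintype.equivOfCardEq ?_
    have aux : ∀ C : Finset α, C ⊆ S → Fintype.card {x : S // x.1 ∈ C} = C.card := by
      intro C hC
      rw [Fintype.card_subtype, ← Finset.card_map (Function.Embedding.subtype _)]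
      congr 1
      ext x
      simp only [Finset.mem_map, Finset.mem_filter, Finset.mem_univ, true_and,
        Function.Embedding.subtype_apply, Subtype.exists, exists_and_left, exists_prop,
        exists_eq_right_right]
      exact ⟨fun h => h.1, fun h => ⟨h, hC h⟩⟩
    rw [aux A hA, aux B hB, h]
  let τ : Equiv.Perm α := Equiv.Perm.ofSubtype (e.extendSubtype : Equiv.Perm {x // x ∈ S})
  refine ⟨τ, fun x hx => Equiv.Perm.ofSubtype_apply_of_not_mem _ hx, ?_⟩
  refine Finset.eq_of_subset_of_card_le ?_ (by rw [Finset.card_map, h])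
  intro y hy
  obtain ⟨x, hx, rfl⟩ := Finset.mem_map.1 hy
  have h1 : τ x = (e.extendSubtype ⟨x, hA hx⟩ : S).1 :=
    Equiv.Perm.ofSubtype_apply_of_mem _ (hA hx)
  have h2 := e.extendSubtype_mem ⟨x, hA hx⟩ hx
  simpa [h1] using h2

/-- Permutations act transitively on pairs of disjoint subsets of given sizes. -/
theorem exists_perm_map_eq_pair {α : Type*} [DecidableEq α] {S A B A' B' : Finset α}
    (hA : A ⊆ S) (hB : B ⊆ S) (hA' : A' ⊆ S) (hB' : B' ⊆ S) (hAB : Disjoint A B)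
    (hAB' : Disjoint A' B') (h : A.card = A'.card) (h' : B.card = B'.card) :
    ∃ σ : Equiv.Perm α, (∀ x ∉ S, σ x = x) ∧ A.map σ.toEmbedding = A' ∧
      B.map σ.toEmbedding = B' := by
  obtain ⟨σ, hσ, hσA⟩ := exists_perm_map_eq hA hA' h
  have hmem : ∀ x, σ x ∈ S ↔ x ∈ S := by
    intro x
    constructor
    · intro hx
      by_contra hx'
      exact hx' (hσ x hx' ▸ hx)
    · intro hx
      by_contra hx'
      exact hx' ((σ.injective (hσ _ hx')).symm ▸ hx)
  -- The second permutation is supported on `S \ A'`, so it leaves `A'`, already in place, fixed.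
  have hBS : B.map σ.toEmbedding ⊆ S \ A' := by
    rw [← hσA]
    intro y hy
    obtain ⟨x, hx, rfl⟩ := Finset.mem_map.1 hy
    refine Finset.mem_sdiff.2 ⟨(hmem x).2 (hB hx), fun hxA => ?_⟩
    exact Finset.disjoint_left.1 hAB ((Finset.mem_map' _).1 hxA) hx
  have hBS' : B' ⊆ S \ A' :=
    fun x hx => Finset.mem_sdiff.2 ⟨hB' hx, Finset.disjoint_right.1 hAB' hx⟩
  obtain ⟨τ, hτ, hτB⟩ := exists_perm_map_eq hBS hBS' (by rw [Finset.card_map, h'])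
  refine ⟨σ.trans τ, fun x hx => ?_, ?_, ?_⟩
  · rw [Equiv.trans_apply, hσ x hx, hτ x (fun h => hx (Finset.mem_sdiff.1 h).1)]
  · have : A'.map τ.toEmbedding = A' := by
      refine Finset.eq_of_subset_of_card_le ?_ (by rw [Finset.card_map])
      intro y hy
      obtain ⟨x, hx, rfl⟩ := Finset.mem_map.1 hy
      have : τ x = x := hτ x (fun h => (Finset.mem_sdiff.1 h).2 hx)
      simpa [this] using hx
    rw [← this, ← hσA, Finset.map_map]
    rfl
  · rw [← hτB, Finset.map_map]
    rfl

/-! ### Matchings and their symmetry -/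

namespace RMatching

variable {r n : ℕ}

theorem subset_of_mem (M : RMatching r n) {e : Finset ℕ} (he : e ∈ M.1.parts) :
    e ⊆ Finset.Icc 1 (r * n) := M.1.subset he

theorem card_parts (hr : r ≠ 0) (M : RMatching r n) : M.1.parts.card = n := by
  have h := M.1.sum_card_parts
  rw [Finset.sum_congr rfl M.2, Finset.sum_const, Nat.card_Icc, smul_eq_mul,
    Nat.add_sub_cancel, mul_comm] at h
  exact Nat.eq_of_mul_eq_mul_left (Nat.pos_of_ne_zero hr) h

theorem mem_powersetCard (M : RMatching r n) {e : Finset ℕ} (he : e ∈ M.1.parts) :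
    e ∈ (Finset.Icc 1 (r * n)).powersetCard r :=
  Finset.mem_powersetCard.2 ⟨M.subset_of_mem he, M.2 e he⟩

theorem nonempty (hr : r ≠ 0) (hn : n ≠ 0) : Nonempty (RMatching r n) := by
  obtain ⟨P, hP, hc⟩ := Finpartition.exists_equipartition_card_eq (Finset.Icc 1 (r * n)) hn
    (by rw [Nat.card_Icc, Nat.add_sub_cancel]
        exact Nat.le_mul_of_pos_left _ (Nat.pos_of_ne_zero hr))
  have hav : (Finset.Icc 1 (r * n)).card / P.parts.card = r := by
    rw [hc, Nat.card_Icc, Nat.add_sub_cancel, Nat.mul_div_cancel _ (Nat.pos_of_ne_zero hn)]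
  -- No part of an equipartition is smaller than the floored average, here exactly `r`; the total
  -- `rn` then forces equality.
  have hge : ∀ e ∈ P.parts, r ≤ e.card := fun e he => hav ▸ hP.average_le_card_part he
  have hsum : ∑ e ∈ P.parts, r = ∑ e ∈ P.parts, e.card := by
    rw [P.sum_card_parts, Finset.sum_const, hc, Nat.card_Icc, smul_eq_mul, Nat.add_sub_cancel,
      mul_comm]
  exact ⟨⟨P, fun e he => ((Finset.sum_eq_sum_iff_of_le hge).1 hsum e he).symm⟩⟩

/-- The image of a matching under a permutation that fixes everything outside `[rn]`. -/
def mapPerm (σ : Equiv.Perm ℕ) (hσ : ∀ x ∉ Finset.Icc 1 (r * n), σ x = x)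
    (M : RMatching r n) : RMatching r n :=
  ⟨(M.1.map (show Finset ℕ ≃o Finset ℕ from
      { σ.finsetCongr with map_rel_iff' := by intro a b; simp })).copy (by
        refine Finset.eq_of_subset_of_card_le ?_ ?_
        · intro y hy
          obtain ⟨x, hx, rfl⟩ := Finset.mem_map.1 (show y ∈ Finset.map σ.toEmbedding _ from hy)
          by_contra hx'
          exact hx' ((σ.injective (hσ _ hx')).symm ▸ hx)
        · exact (Finset.card_map σ.toEmbedding).ge), by
    intro e he
    obtain ⟨f, hf, rfl⟩ := Finset.mem_map.1 he
    exact (Finset.card_map σ.toEmbedding).trans (M.2 f hf)⟩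

theorem mem_mapPerm_parts (σ : Equiv.Perm ℕ) (hσ : ∀ x ∉ Finset.Icc 1 (r * n), σ x = x)
    (M : RMatching r n) {e : Finset ℕ} :
    e.map σ.toEmbedding ∈ (mapPerm σ hσ M).1.parts ↔ e ∈ M.1.parts := by
  constructor
  · intro h
    obtain ⟨f, hf, hfe⟩ := Finset.mem_map.1 h
    have : f = e := Finset.map_injective σ.toEmbedding hfe
    exact this ▸ hf
  · intro h
    exact Finset.mem_map.2 ⟨e, h, rfl⟩

theorem mapPerm_injective (σ : Equiv.Perm ℕ) (hσ : ∀ x ∉ Finset.Icc 1 (r * n), σ x = x) :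
    Function.Injective (mapPerm (r := r) (n := n) σ hσ) := by
  intro M M' h
  apply Subtype.ext
  ext e
  rw [← mem_mapPerm_parts σ hσ M, h, mem_mapPerm_parts]

/-- The number of matchings containing two given disjoint edges does not depend on the edges. -/
theorem card_filter_pair_le {e f e' f' : Finset ℕ} (he : e ⊆ Finset.Icc 1 (r * n))
    (hf : f ⊆ Finset.Icc 1 (r * n)) (he' : e' ⊆ Finset.Icc 1 (r * n))
    (hf' : f' ⊆ Finset.Icc 1 (r * n)) (hef : Disjoint e f) (hef' : Disjoint e' f')
    (h : e.card = e'.card) (h' : f.card = f'.card) :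
    (Finset.univ.filter fun M : RMatching r n => e ∈ M.1.parts ∧ f ∈ M.1.parts).card ≤
      (Finset.univ.filter fun M : RMatching r n => e' ∈ M.1.parts ∧ f' ∈ M.1.parts).card := by
  obtain ⟨σ, hσ, rfl, rfl⟩ := exists_perm_map_eq_pair he hf he' hf' hef hef' h h'
  refine Finset.card_le_card_of_injOn (mapPerm σ hσ) ?_ (mapPerm_injective σ hσ).injOn
  intro M hM
  simpa [mem_mapPerm_parts] using hM

theorem card_filter_le {e e' : Finset ℕ} (he : e ⊆ Finset.Icc 1 (r * n))
    (he' : e' ⊆ Finset.Icc 1 (r * n)) (h : e.card = e'.card) :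
    (Finset.univ.filter fun M : RMatching r n => e ∈ M.1.parts).card ≤
      (Finset.univ.filter fun M : RMatching r n => e' ∈ M.1.parts).card := by
  obtain ⟨σ, hσ, rfl⟩ := exists_perm_map_eq he he' h
  refine Finset.card_le_card_of_injOn (mapPerm σ hσ) ?_ (mapPerm_injective σ hσ).injOn
  intro M hM
  simpa [mem_mapPerm_parts] using hM

end RMatching

/-! ### Double counting of edges and pairs of edges -/

/-- Double counting for an incidence relation that is regular on the side of `S`. -/
theorem card_mul_sum_sum_filter_eq {α ι : Type*} [Fintype α] (S : Finset ι) (R : α → ι → Prop)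
    [∀ a, DecidablePred (R a)] [∀ i, DecidablePred fun a => R a i]
    (hR : ∀ i ∈ S, ∀ j ∈ S, (Finset.univ.filter fun a => R a i).card ≤
      (Finset.univ.filter fun a => R a j).card) {d : ℕ}
    (hd : ∀ a, (S.filter (R a)).card = d) (g : ι → ℝ) :
    (S.card : ℝ) * ∑ a, ∑ i ∈ S.filter (R a), g i = Fintype.card α * d * ∑ i ∈ S, g i := by
  rcases S.eq_empty_or_nonempty with rfl | ⟨j, hj⟩
  · simp
  have key : ∀ g : ι → ℝ, ∑ a, ∑ i ∈ S.filter (R a), g i =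
      (Finset.univ.filter fun a => R a j).card * ∑ i ∈ S, g i := by
    intro g
    simp_rw [Finset.sum_filter]
    rw [Finset.sum_comm, Finset.mul_sum]
    refine Finset.sum_congr rfl fun i hi => ?_
    rw [← Finset.sum_filter, Finset.sum_const, nsmul_eq_mul,
      le_antisymm (hR i hi j hj) (hR j hj i hi)]
  -- The constant function 1 counts all incidences and so evaluates the common degree.
  have h1 := key 1
  simp only [Pi.one_apply, Finset.sum_const, hd, nsmul_eq_mul, mul_one, Finset.card_univ] at h1
  rw [key, h1]
  ring

namespace RMatching

variable {r n : ℕ}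

theorem card_mul_sum_sum_parts (hr : r ≠ 0) (g : Finset ℕ → ℝ) :
    ((r * n).choose r : ℝ) * ∑ M : RMatching r n, ∑ e ∈ M.1.parts, g e =
      Fintype.card (RMatching r n) * n * ∑ e ∈ (Finset.Icc 1 (r * n)).powersetCard r, g e := by
  classical
  have hfil : ∀ M : RMatching r n,
      ((Finset.Icc 1 (r * n)).powersetCard r).filter (fun e => e ∈ M.1.parts) = M.1.parts := by
    intro M
    ext e
    simp only [Finset.mem_filter, and_iff_right_iff_imp]
    exact M.mem_powersetCard
  have := card_mul_sum_sum_filter_eq (α := RMatching r n)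
    ((Finset.Icc 1 (r * n)).powersetCard r) (fun M e => e ∈ M.1.parts) (d := n)
    (fun e he f hf => by
      rw [Finset.mem_powersetCard] at he hf
      exact card_filter_le he.1 hf.1 (he.2.trans hf.2.symm))
    (fun M => by rw [hfil, card_parts hr]) g
  simpa only [hfil, Finset.card_powersetCard, Nat.card_Icc, Nat.add_sub_cancel] using this

/-- The ordered pairs of disjoint `r`-subsets of `[rn]`. -/
def disjointPairs (r n : ℕ) : Finset (Finset ℕ × Finset ℕ) :=
  ((Finset.Icc 1 (r * n)).powersetCard r ×ˢ (Finset.Icc 1 (r * n)).powersetCard r).filter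
    fun p => Disjoint p.1 p.2

theorem mem_disjointPairs {p : Finset ℕ × Finset ℕ} : p ∈ disjointPairs r n ↔
    ((p.1 ⊆ Finset.Icc 1 (r * n) ∧ p.1.card = r) ∧ p.2 ⊆ Finset.Icc 1 (r * n) ∧
      p.2.card = r) ∧ Disjoint p.1 p.2 := by
  simp [disjointPairs, Finset.mem_powersetCard]

theorem card_disjointPairs :
    (disjointPairs r n).card = (r * n).choose r * (r * n - r).choose r := by
  rw [disjointPairs, Finset.card_filter, Finset.sum_product]
  have : ∀ e ∈ (Finset.Icc 1 (r * n)).powersetCard r,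
      (∑ f ∈ (Finset.Icc 1 (r * n)).powersetCard r, if Disjoint e f then 1 else 0) =
        (r * n - r).choose r := by
    intro e he
    rw [Finset.mem_powersetCard] at he
    rw [← Finset.card_filter]
    have : ((Finset.Icc 1 (r * n)).powersetCard r).filter (fun f => Disjoint e f) =
        (Finset.Icc 1 (r * n) \ e).powersetCard r := by
      ext f
      simp only [Finset.mem_filter, Finset.mem_powersetCard, Finset.subset_sdiff, disjoint_comm]
      tauto
    rw [this, Finset.card_powersetCard, Finset.card_sdiff_of_subset he.1, he.2, Nat.card_Icc,
      Nat.add_sub_cancel]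
  rw [Finset.sum_congr rfl this, Finset.sum_const, Finset.card_powersetCard, Nat.card_Icc,
    Nat.add_sub_cancel, smul_eq_mul]

theorem card_mul_sum_sum_offDiag (hr : r ≠ 0) (g : Finset ℕ × Finset ℕ → ℝ) :
    ((disjointPairs r n).card : ℝ) * ∑ M : RMatching r n, ∑ p ∈ M.1.parts.offDiag, g p =
      Fintype.card (RMatching r n) * (n * n - n : ℕ) * ∑ p ∈ disjointPairs r n, g p := by
  classical
  have hfil : ∀ M : RMatching r n, (disjointPairs r n).filter
      (fun p => p.1 ∈ M.1.parts ∧ p.2 ∈ M.1.parts) = M.1.parts.offDiag := by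
    intro M
    ext p
    rw [Finset.mem_filter, mem_disjointPairs, Finset.mem_offDiag]
    constructor
    · rintro ⟨⟨⟨h1, -⟩, hd⟩, h2, h3⟩
      refine ⟨h2, h3, fun h => ?_⟩
      rw [← h, disjoint_self] at hd
      exact M.1.ne_bot h2 hd
    · rintro ⟨h2, h3, hne⟩
      exact ⟨⟨⟨⟨M.subset_of_mem h2, M.2 _ h2⟩, M.subset_of_mem h3, M.2 _ h3⟩,
        M.1.disjoint h2 h3 hne⟩, h2, h3⟩
  have := card_mul_sum_sum_filter_eq (α := RMatching r n)
    (disjointPairs r n) (fun M p => p.1 ∈ M.1.parts ∧ p.2 ∈ M.1.parts) (d := n * n - n)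
    (fun p hp q hq => by
      rw [mem_disjointPairs] at hp hq
      exact card_filter_pair_le hp.1.1.1 hp.1.2.1 hq.1.1.1 hq.1.2.1 hp.2 hq.2
        (hp.1.1.2.trans hq.1.1.2.symm) (hp.1.2.2.trans hq.1.2.2.symm))
    (fun M => by rw [hfil, Finset.offDiag_card, card_parts hr]) g
  simpa only [hfil] using this

end RMatching

/-! ### Maxima of edges and the sockuence -/

/-- The sum of the maxima of all nonempty subsets of `[N]` of a given size. -/
theorem sum_powersetCard_sup (s N : ℕ) :
    ((s : ℝ) + 2) * ∑ e ∈ (Finset.Icc 1 N).powersetCard (s + 1), ((e.sup id : ℕ) : ℝ) =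
      (s + 1) * (N + 1) * (N.choose (s + 1)) := by
  induction N with
  | zero => simp [Finset.powersetCard_eq_empty.2 (show (∅ : Finset ℕ).card < s + 1 by simp)]
  | succ N ih =>
    have hN : N + 1 ∉ Finset.Icc 1 N := by simp
    have hsucc : Finset.Icc 1 (N + 1) = insert (N + 1) (Finset.Icc 1 N) := by
      ext x
      simp only [Finset.mem_Icc, Finset.mem_insert]
      omega
    rw [hsucc, Finset.powersetCard_succ_insert hN, Finset.sum_union, Finset.sum_image]
    · have hins : ∀ e ∈ (Finset.Icc 1 N).powersetCard s,
          (((insert (N + 1) e).sup id : ℕ) : ℝ) = N + 1 := by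
        intro e he
        rw [Finset.mem_powersetCard] at he
        have : e.sup id ≤ N + 1 := Finset.sup_le fun x hx => by
          have := Finset.mem_Icc.1 (he.1 hx)
          simp only [id]
          omega
        rw [Finset.sup_insert, id, sup_eq_left.2 this]
        push_cast
        ring
      rw [Finset.sum_congr rfl hins, Finset.sum_const, Finset.card_powersetCard, Nat.card_Icc,
        Nat.add_sub_cancel, nsmul_eq_mul, mul_add, ih, Nat.choose_succ_succ]
      -- The real subtraction is harmless for `s > N`, where both binomial coefficients vanish.
      have hch : ((N.choose (s + 1) : ℕ) : ℝ) * (s + 1) = N.choose s * (N - s) := by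
        rcases le_or_gt s N with h | h
        · have := Nat.choose_succ_right_eq N s
          rw [← Nat.cast_sub h]
          exact_mod_cast this
        · simp [Nat.choose_eq_zero_of_lt h, Nat.choose_eq_zero_of_lt (h.trans (Nat.lt_succ_self s))]
      push_cast
      linear_combination (-1) * hch
    · intro e he f hf h
      have he := (Finset.mem_powersetCard.1 he).1
      have hf := (Finset.mem_powersetCard.1 hf).1
      rw [← Finset.erase_insert (fun h => hN (he h)), h, Finset.erase_insert fun h => hN (hf h)]
    · rw [Finset.disjoint_left]
      intro e he he'
      obtain ⟨f, -, rfl⟩ := Finset.mem_image.1 he'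
      exact hN ((Finset.mem_powersetCard.1 he).1 (Finset.mem_insert_self _ _))

/-- The contribution of one edge to the sum of the sockuence. -/
theorem sum_card_inter_Icc {N : ℕ} {e : Finset ℕ} (he : e ⊆ Finset.Icc 1 N) :
    ∑ k ∈ Finset.Icc 1 N, (if (e ∩ Finset.Icc 1 k).Nonempty ∧
      (e ∩ (Finset.Icc 1 N \ Finset.Icc 1 k)).Nonempty
        then ((e ∩ Finset.Icc 1 k).card : ℝ) else 0) =
      ∑ x ∈ e, (((e.sup id : ℕ) : ℝ) - x) := by
  -- If `e` misses `[k]` the cardinality is 0 anyway, so the only real restriction is `k < max e`.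
  have h1 : ∀ k ∈ Finset.Icc 1 N, (if (e ∩ Finset.Icc 1 k).Nonempty ∧
      (e ∩ (Finset.Icc 1 N \ Finset.Icc 1 k)).Nonempty
        then ((e ∩ Finset.Icc 1 k).card : ℝ) else 0) =
      ∑ x ∈ e, if x ≤ k ∧ k < e.sup id then 1 else 0 := by
    intro k _
    have hlt : (e ∩ (Finset.Icc 1 N \ Finset.Icc 1 k)).Nonempty ↔ k < e.sup id := by
      rw [Finset.lt_sup_iff]
      constructor
      · rintro ⟨x, hx⟩
        simp only [Finset.mem_inter, Finset.mem_sdiff, Finset.mem_Icc] at hx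
        exact ⟨x, hx.1, by simp only [id]; omega⟩
      · rintro ⟨x, hx, hk⟩
        have := Finset.mem_Icc.1 (he hx)
        simp only [id] at hk
        refine ⟨x, ?_⟩
        simp only [Finset.mem_inter, Finset.mem_sdiff, Finset.mem_Icc]
        exact ⟨hx, this, by omega⟩
    have hinter : e ∩ Finset.Icc 1 k = e.filter (· ≤ k) := by
      ext x
      simp only [Finset.mem_inter, Finset.mem_filter, Finset.mem_Icc]
      exact and_congr_right fun hx => and_iff_right (Finset.mem_Icc.1 (he hx)).1
    simp only [hlt]
    by_cases hk : k < e.sup id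
    · simp only [hk, and_true, ← hinter, Finset.sum_boole]
      rcases (e ∩ Finset.Icc 1 k).eq_empty_or_nonempty with h | h
      · simp [h]
      · simp [h]
    · simp [hk]
  rw [Finset.sum_congr rfl h1, Finset.sum_comm]
  refine Finset.sum_congr rfl fun x hx => ?_
  have hxs : x ≤ e.sup id := Finset.le_sup (f := id) hx
  have hsN : e.sup id ≤ N := Finset.sup_le fun y hy => (Finset.mem_Icc.1 (he hy)).2
  have hx1 := (Finset.mem_Icc.1 (he hx)).1
  have : (Finset.Icc 1 N).filter (fun k => x ≤ k ∧ k < e.sup id) = Finset.Ico x (e.sup id) := by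
    ext k
    simp only [Finset.mem_filter, Finset.mem_Icc, Finset.mem_Ico]
    omega
  rw [Finset.sum_boole, this, Nat.card_Ico, Nat.cast_sub hxs]

theorem sum_Icc_cast (N : ℕ) : ∑ x ∈ Finset.Icc 1 N, (x : ℝ) = N * (N + 1) / 2 := by
  induction N with
  | zero => simp
  | succ N ih =>
    rw [Finset.sum_Icc_succ_top (by omega), ih]
    push_cast
    ring

theorem sum_sockuence {r n : ℕ} (M : RMatching r n) :
    ∑ k ∈ Finset.Icc 1 (r * n), (sockuence M k : ℝ) =
      r * ∑ e ∈ M.1.parts, ((e.sup id : ℕ) : ℝ) - (r * n) * (r * n + 1) / 2 := by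
  have h1 : ∀ k, (sockuence M k : ℝ) = ∑ e ∈ M.1.parts, if (e ∩ Finset.Icc 1 k).Nonempty ∧
      (e ∩ (Finset.Icc 1 (r * n) \ Finset.Icc 1 k)).Nonempty
        then ((e ∩ Finset.Icc 1 k).card : ℝ) else 0 := by
    intro k
    rw [sockuence, openEdges, Nat.cast_sum, Finset.sum_filter]
  simp_rw [h1]
  rw [Finset.sum_comm, Finset.sum_congr rfl fun e he => sum_card_inter_Icc (M.subset_of_mem he)]
  simp_rw [Finset.sum_sub_distrib]
  congr 1
  · rw [Finset.mul_sum]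
    exact Finset.sum_congr rfl fun e he => by rw [Finset.sum_const, M.2 e he, nsmul_eq_mul]
  · have := Finset.sum_biUnion (s := M.1.parts) (t := id) (f := fun x : ℕ => (x : ℝ))
      M.1.disjoint
    rw [M.1.biUnion_parts, sum_Icc_cast] at this
    refine this.symm.trans ?_
    push_cast
    ring

/-- The expected value of the maximum of a random `r`-subset of `[rn]`. -/
noncomputable def meanMax (r n : ℕ) : ℝ := r * (r * n + 1) / (r + 1)

theorem averageSockuence_sub {r n : ℕ} (hr : r ≠ 0) (hn : n ≠ 0) (M : RMatching r n) :
    averageSockuence M - ((r : ℝ) - 1) * ((r : ℝ) * n + 1) / (2 * ((r : ℝ) + 1)) =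
      (∑ e ∈ M.1.parts, (((e.sup id : ℕ) : ℝ) - meanMax r n)) / n := by
  have hr' : (r : ℝ) ≠ 0 := Nat.cast_ne_zero.2 hr
  have hn' : (n : ℝ) ≠ 0 := Nat.cast_ne_zero.2 hn
  have hr1 : (r : ℝ) + 1 ≠ 0 := by positivity
  rw [averageSockuence, sum_sockuence, Finset.sum_sub_distrib, Finset.sum_const,
    RMatching.card_parts hr, nsmul_eq_mul, meanMax]
  field_simp
  ring

theorem sum_powersetCard_sup_sub_meanMax {r n : ℕ} (hr : r ≠ 0) :
    ∑ e ∈ (Finset.Icc 1 (r * n)).powersetCard r, (((e.sup id : ℕ) : ℝ) - meanMax r n) = 0 := by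
  obtain ⟨s, rfl⟩ := Nat.exists_eq_succ_of_ne_zero hr
  have h := sum_powersetCard_sup s ((s + 1) * n)
  rw [Finset.sum_sub_distrib, Finset.sum_const, Finset.card_powersetCard, Nat.card_Icc,
    Nat.add_sub_cancel, nsmul_eq_mul, meanMax, sub_eq_zero]
  have hs : (s : ℝ) + 2 ≠ 0 := by positivity
  have hs' : ((s.succ : ℕ) : ℝ) + 1 = s + 2 := by push_cast; ring
  rw [hs']
  field_simp
  rw [mul_comm, h]
  push_cast
  ring

theorem abs_sup_sub_meanMax_le {r n : ℕ} (hn : n ≠ 0) {e : Finset ℕ}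
    (he : e ⊆ Finset.Icc 1 (r * n)) :
    |((e.sup id : ℕ) : ℝ) - meanMax r n| ≤ r * n := by
  have h1 : ((e.sup id : ℕ) : ℝ) ≤ r * n := by
    exact_mod_cast (Finset.sup_le fun y hy => (Finset.mem_Icc.1 (he hy)).2 : e.sup id ≤ r * n)
  have h0 : (0 : ℝ) ≤ ((e.sup id : ℕ) : ℝ) := Nat.cast_nonneg _
  have hr0 : (0 : ℝ) ≤ r := Nat.cast_nonneg _
  have hn1 : (1 : ℝ) ≤ n := by exact_mod_cast Nat.one_le_iff_ne_zero.2 hn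
  have h2 : 0 ≤ meanMax r n := by rw [meanMax]; positivity
  have h3 : meanMax r n ≤ r * n := by
    rw [meanMax, div_le_iff₀ (by positivity)]
    nlinarith
  rw [abs_le]
  constructor <;> linarith

/-! ### Second moment -/

/-- Union bound: an `r`-set that meets a given `j`-set contains one of its `j` points. The induction
removes one point at a time by Pascal's rule. -/
theorem choose_le_choose_sub_add (N r j : ℕ) (hr : r ≠ 0) :
    N.choose r ≤ (N - j).choose r + j * (N - 1).choose (r - 1) := by
  obtain ⟨s, rfl⟩ := Nat.exists_eq_succ_of_ne_zero hr
  induction j with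
  | zero => simp
  | succ j ih =>
    refine ih.trans ?_
    have : (N - j).choose s.succ ≤ (N - (j + 1)).choose s.succ + (N - 1).choose s := by
      rcases Nat.eq_zero_or_pos (N - j) with h | h
      · simp [h]
      · obtain ⟨m, hm⟩ := Nat.exists_eq_succ_of_ne_zero h.ne'
        rw [hm, show N - (j + 1) = m by omega, Nat.succ_eq_add_one, Nat.succ_eq_add_one,
          Nat.choose_succ_succ, add_comm]
        exact Nat.add_le_add_left (Nat.choose_le_choose _ (by omega)) _
    simp only [Nat.succ_eq_add_one, Nat.add_sub_cancel] at this ⊢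
    linarith

/-- A given point lies in a proportion `1/n` of the `r`-subsets of `[rn]`, so at most a proportion
`r/n` of them meet a given `r`-set. -/
theorem mul_choose_le {r n : ℕ} (hr : r ≠ 0) (hn : n ≠ 0) :
    n * (r * n).choose r ≤ n * (r * n - r).choose r + r * (r * n).choose r := by
  have h := choose_le_choose_sub_add (r * n) r r hr
  have h2 : n * (r * n - 1).choose (r - 1) = (r * n).choose r := by
    have h3 := Nat.add_one_mul_choose_eq (r * n - 1) (r - 1)
    have : 0 < r * n := Nat.mul_pos (Nat.pos_of_ne_zero hr) (Nat.pos_of_ne_zero hn)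
    rw [Nat.sub_add_cancel this, Nat.sub_add_cancel (Nat.pos_of_ne_zero hr)] at h3
    refine Nat.eq_of_mul_eq_mul_left (Nat.pos_of_ne_zero hr) ?_
    rw [← mul_assoc, h3, mul_comm]
  calc n * (r * n).choose r
      ≤ n * ((r * n - r).choose r + r * (r * n - 1).choose (r - 1)) := Nat.mul_le_mul_left _ h
    _ = _ := by rw [mul_add, mul_left_comm, h2]

namespace RMatching

variable {r n : ℕ}

/-- A centred function has small total over the pairs of disjoint sets, as few pairs meet. -/
theorem sum_disjointPairs_le {g : Finset ℕ → ℝ} {B : ℝ}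
    (hg : ∑ e ∈ (Finset.Icc 1 (r * n)).powersetCard r, g e = 0)
    (hB : ∀ e ∈ (Finset.Icc 1 (r * n)).powersetCard r, |g e| ≤ B) :
    ∑ p ∈ disjointPairs r n, g p.1 * g p.2 ≤
      (((r * n).choose r : ℝ) ^ 2 - (disjointPairs r n).card) * B ^ 2 := by
  set P := (Finset.Icc 1 (r * n)).powersetCard r with hP
  have hPc : P.card = (r * n).choose r := by
    rw [hP, Finset.card_powersetCard, Nat.card_Icc, Nat.add_sub_cancel]
  have hD : disjointPairs r n = (P ×ˢ P).filter fun p => Disjoint p.1 p.2 := rfl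
  have hzero : ∑ p ∈ P ×ˢ P, g p.1 * g p.2 = 0 := by
    rw [Finset.sum_product, ← Finset.sum_mul_sum, hg, zero_mul]
  have hsplit := Finset.sum_filter_add_sum_filter_not (P ×ˢ P)
    (fun p => Disjoint p.1 p.2) (fun p => g p.1 * g p.2)
  have hcard := Finset.card_filter_add_card_filter_not (s := P ×ˢ P)
    (fun p => Disjoint p.1 p.2)
  rw [← hD, Finset.card_product, hPc] at hcard
  rw [← hD, hzero] at hsplit
  have hcard' : (((P ×ˢ P).filter fun p => ¬ Disjoint p.1 p.2).card : ℝ) =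
      ((r * n).choose r : ℝ) ^ 2 - (disjointPairs r n).card := by
    rw [sq, ← Nat.cast_mul, ← hcard]
    push_cast
    ring
  rw [← hcard', ← nsmul_eq_mul, eq_neg_of_add_eq_zero_left hsplit, ← Finset.sum_neg_distrib]
  refine Finset.sum_le_card_nsmul _ _ _ fun p hp => ?_
  obtain ⟨h1, h2⟩ := Finset.mem_product.1 (Finset.mem_filter.1 hp).1
  have h3 := mul_le_mul (hB _ h1) (hB _ h2) (abs_nonneg _) ((abs_nonneg _).trans (hB _ h1))
  rw [← abs_mul, ← sq] at h3
  exact (neg_le_abs _).trans h3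

theorem sum_offDiag_le (hr : r ≠ 0) (hn : 2 * r ≤ n) {g : Finset ℕ → ℝ} {B : ℝ}
    (hg : ∑ e ∈ (Finset.Icc 1 (r * n)).powersetCard r, g e = 0)
    (hB : ∀ e ∈ (Finset.Icc 1 (r * n)).powersetCard r, |g e| ≤ B) :
    ∑ M : RMatching r n, ∑ p ∈ M.1.parts.offDiag, g p.1 * g p.2 ≤
      Fintype.card (RMatching r n) * (2 * r * n * B ^ 2) := by
  have hn0 : n ≠ 0 := by omega
  have hch : (n : ℝ) * (r * n).choose r ≤ n * (r * n - r).choose r + r * (r * n).choose r := by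
    exact_mod_cast mul_choose_le hr hn0
  have h := card_mul_sum_sum_offDiag (n := n) hr fun p => g p.1 * g p.2
  have hD := sum_disjointPairs_le hg hB
  set D := (disjointPairs r n).card with hDdef
  have hDc : (D : ℝ) = (r * n).choose r * (r * n - r).choose r := by
    rw [hDdef, card_disjointPairs]
    push_cast
    rfl
  have hTpos : (0 : ℝ) < (r * n).choose r := by
    exact_mod_cast Nat.choose_pos (Nat.le_mul_of_pos_right _ (Nat.pos_of_ne_zero hn0))
  have hCT : (((r * n - r).choose r : ℕ) : ℝ) ≤ (((r * n).choose r : ℕ) : ℝ) :=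
    Nat.cast_le.2 (Nat.choose_le_choose r (Nat.sub_le _ _))
  set T : ℝ := (((r * n).choose r : ℕ) : ℝ)
  set C : ℝ := (((r * n - r).choose r : ℕ) : ℝ)
  clear_value T C D
  have hnR : (2 : ℝ) * r ≤ n := by exact_mod_cast hn
  have hnpos : (0 : ℝ) < n := by exact_mod_cast Nat.pos_of_ne_zero hn0
  have hr0 : (0 : ℝ) ≤ r := Nat.cast_nonneg _
  -- By `2r ≤ n`, at least half of the `r`-subsets avoid a given one.
  have hTC : T ≤ 2 * C := by
    have : n * T ≤ n * (2 * C) := by nlinarith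
    exact le_of_mul_le_mul_left this hnpos
  have hDpos : (0 : ℝ) < D := by
    rw [hDc]
    exact mul_pos hTpos (by linarith)
  have hTD : 0 ≤ T ^ 2 - D := by
    rw [hDc]
    nlinarith
  -- `T ^ 2 - D` counts the intersecting pairs: they are at most `2r/n` times as many as the
  -- disjoint ones.
  have hbound : ((n * n - n : ℕ) : ℝ) * (T ^ 2 - D) ≤ D * (2 * r * n) := by
    have h1 : ((n * n - n : ℕ) : ℝ) ≤ n * n := by exact_mod_cast Nat.sub_le _ _
    have h2 : (n : ℝ) * (T - C) ≤ 2 * r * C := by nlinarith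
    calc ((n * n - n : ℕ) : ℝ) * (T ^ 2 - D) ≤ n * n * (T ^ 2 - D) :=
          mul_le_mul_of_nonneg_right h1 hTD
      _ = (n * T) * (n * (T - C)) := by rw [hDc]; ring
      _ ≤ (n * T) * (2 * r * C) := mul_le_mul_of_nonneg_left h2 (by positivity)
      _ = D * (2 * r * n) := by rw [hDc]; ring
  refine le_of_mul_le_mul_left ?_ hDpos
  rw [h]
  calc _ ≤ (Fintype.card (RMatching r n) : ℝ) * (n * n - n : ℕ) * ((T ^ 2 - D) * B ^ 2) :=
        mul_le_mul_of_nonneg_left hD (by positivity)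
    _ = Fintype.card (RMatching r n) * B ^ 2 * (((n * n - n : ℕ) : ℝ) * (T ^ 2 - D)) := by ring
    _ ≤ Fintype.card (RMatching r n) * B ^ 2 * (D * (2 * r * n)) :=
        mul_le_mul_of_nonneg_left hbound (by positivity)
    _ = _ := by ring

/-- Second moment bound for a centred sum over the edges of a random matching. -/
theorem sum_sq_sum_parts_le (hr : r ≠ 0) (hn : 2 * r ≤ n) {g : Finset ℕ → ℝ} {B : ℝ}
    (hg : ∑ e ∈ (Finset.Icc 1 (r * n)).powersetCard r, g e = 0)
    (hB : ∀ e ∈ (Finset.Icc 1 (r * n)).powersetCard r, |g e| ≤ B) :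
    ∑ M : RMatching r n, (∑ e ∈ M.1.parts, g e) ^ 2 ≤
      Fintype.card (RMatching r n) * ((2 * r + 1) * n * B ^ 2) := by
  classical
  have hsq : ∀ M : RMatching r n, (∑ e ∈ M.1.parts, g e) ^ 2 =
      ∑ e ∈ M.1.parts, g e ^ 2 + ∑ p ∈ M.1.parts.offDiag, g p.1 * g p.2 := by
    intro M
    rw [sq, Finset.sum_mul_sum, ← Finset.sum_product', ← Finset.diag_union_offDiag,
      Finset.sum_union (Finset.disjoint_diag_offDiag _), Finset.sum_diag]
    simp only [sq]
  have hdiag : ∑ M : RMatching r n, ∑ e ∈ M.1.parts, g e ^ 2 ≤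
      Fintype.card (RMatching r n) * (n * B ^ 2) := by
    rw [← nsmul_eq_mul, ← Finset.card_univ]
    refine Finset.sum_le_card_nsmul _ _ _ fun M _ => ?_
    have := Finset.sum_le_card_nsmul M.1.parts (fun e => g e ^ 2) (B ^ 2) fun e he => by
      have := hB e (M.mem_powersetCard he)
      exact sq_le_sq' (abs_le.1 this).1 (abs_le.1 this).2
    rwa [card_parts hr, nsmul_eq_mul] at this
  simp_rw [hsq]
  rw [Finset.sum_add_distrib]
  refine (add_le_add hdiag (sum_offDiag_le hr hn hg hB)).trans (le_of_eq ?_)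
  ring

theorem sum_averageSockuence_sub (hr : r ≠ 0) (hn : n ≠ 0) :
    ∑ M : RMatching r n,
      (averageSockuence M - ((r : ℝ) - 1) * ((r : ℝ) * n + 1) / (2 * ((r : ℝ) + 1))) = 0 := by
  have h := card_mul_sum_sum_parts (n := n) hr fun e => ((e.sup id : ℕ) : ℝ) - meanMax r n
  rw [sum_powersetCard_sup_sub_meanMax hr, mul_zero, mul_eq_zero] at h
  have hT : ((r * n).choose r : ℝ) ≠ 0 := by
    exact_mod_cast (Nat.choose_pos (Nat.le_mul_of_pos_right _ (Nat.pos_of_ne_zero hn))).ne'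
  simp_rw [averageSockuence_sub hr hn]
  rw [← Finset.sum_div, h.resolve_left hT, zero_div]

/-- The bound `B = rn` on the centred maxima gives order `n³` for the sum over edges, and the factor
`1/n²` leaves order `n`. -/
theorem sum_sq_averageSockuence_sub_le (hr : r ≠ 0) (hn : 2 * r ≤ n) :
    ∑ M : RMatching r n,
      (averageSockuence M - ((r : ℝ) - 1) * ((r : ℝ) * n + 1) / (2 * ((r : ℝ) + 1))) ^ 2 ≤
      (Fintype.card (RMatching r n) : ℝ) * ((2 * (r : ℝ) + 1) * (r : ℝ) ^ 2 * n) := by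
  have hn0 : n ≠ 0 := by omega
  have hn' : (n : ℝ) ≠ 0 := Nat.cast_ne_zero.2 hn0
  simp_rw [averageSockuence_sub hr hn0, div_pow]
  rw [← Finset.sum_div, div_le_iff₀ (by positivity)]
  refine (sum_sq_sum_parts_le hr hn (sum_powersetCard_sup_sub_meanMax hr)
    (B := r * n) fun e he => ?_).trans (le_of_eq (by ring))
  exact abs_sup_sub_meanMax_le hn0 (Finset.mem_powersetCard.1 he).1

end RMatching

/-! ### Expectation and concentration -/

theorem isProbabilityMeasure_randomRMatching {r n : ℕ} (hr : r ≠ 0) (hn : n ≠ 0) :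
    IsProbabilityMeasure (randomRMatching r n) := by
  have := RMatching.nonempty hr hn
  exact isProbabilityMeasure_uniformOn Set.finite_univ Set.univ_nonempty

theorem integral_randomRMatching {r n : ℕ} (f : RMatching r n → ℝ) :
    ∫ M, f M ∂(randomRMatching r n) =
      (Fintype.card (RMatching r n) : ℝ)⁻¹ * ∑ M, f M := by
  rw [randomRMatching, uniformOn, ProbabilityTheory.cond, Measure.restrict_univ,
    integral_smul_measure, integral_count, Measure.count_univ]
  simp

theorem theorem3 (r : ℕ) (hr : 2 ≤ r) :
    (∀ n : ℕ, 1 ≤ n →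
      ∫ M, averageSockuence M ∂(randomRMatching r n)
        = ((r : ℝ) - 1) * ((r : ℝ) * n + 1) / (2 * ((r : ℝ) + 1))) ∧
    (∀ ω : ℕ → ℝ, Tendsto ω atTop atTop →
      Tendsto
        (fun n : ℕ => (randomRMatching r n).real
          {M : RMatching r n |
            |averageSockuence M - ((r : ℝ) - 1) * ((r : ℝ) * n) / (2 * ((r : ℝ) + 1))|
              ≤ ω n * √(n : ℝ)})
        atTop (𝓝 1)) := by
  have hr0 : r ≠ 0 := by omega
  refine ⟨fun n hn => ?_, fun ω hω => ?_⟩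
  · have hn0 : n ≠ 0 := by omega
    have := isProbabilityMeasure_randomRMatching hr0 hn0
    have h := integral_randomRMatching fun M : RMatching r n =>
      averageSockuence M - ((r : ℝ) - 1) * ((r : ℝ) * n + 1) / (2 * ((r : ℝ) + 1))
    rw [RMatching.sum_averageSockuence_sub hr0 hn0, mul_zero,
      integral_sub Integrable.of_finite Integrable.of_finite, integral_const, probReal_univ,
      one_smul, sub_eq_zero] at h
    exact h
  -- The event is centred at a point `δ ≤ 1` below the mean; `(x + δ)² ≤ 2x² + 2` accounts for the
  -- factor 2 and the summand 2.
  · set K : ℝ := 2 * ((2 * r + 1) * r ^ 2) + 2 with hK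
    have hlow : ∀ᶠ n : ℕ in atTop, 1 - K / ω n ^ 2 ≤ (randomRMatching r n).real
          {M : RMatching r n |
            |averageSockuence M - ((r : ℝ) - 1) * ((r : ℝ) * n) / (2 * ((r : ℝ) + 1))|
              ≤ ω n * √(n : ℝ)} := by
      filter_upwards [eventually_ge_atTop (2 * r), hω.eventually_gt_atTop 0] with n hn hωn
      have hn0 : n ≠ 0 := by omega
      have hnpos : (0 : ℝ) < n := by exact_mod_cast Nat.pos_of_ne_zero hn0
      have hn1 : (1 : ℝ) ≤ n := by exact_mod_cast Nat.one_le_iff_ne_zero.2 hn0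
      have := isProbabilityMeasure_randomRMatching hr0 hn0
      have hne := RMatching.nonempty hr0 hn0
      have hcard : (0 : ℝ) < Fintype.card (RMatching r n) := by
        exact_mod_cast Fintype.card_pos
      set f : RMatching r n → ℝ := fun M =>
        averageSockuence M - ((r : ℝ) - 1) * ((r : ℝ) * n) / (2 * ((r : ℝ) + 1)) with hf
      have hsum : ∑ M, f M ^ 2 ≤ Fintype.card (RMatching r n) * (K * n) := by
        have h1 : ∀ M : RMatching r n, f M ^ 2 ≤ 2 * (averageSockuence M -
            ((r : ℝ) - 1) * ((r : ℝ) * n + 1) / (2 * ((r : ℝ) + 1))) ^ 2 + 2 := by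
          intro M
          set x := averageSockuence M -
            ((r : ℝ) - 1) * ((r : ℝ) * n + 1) / (2 * ((r : ℝ) + 1)) with hx
          set δ : ℝ := ((r : ℝ) - 1) / (2 * ((r : ℝ) + 1)) with hδ
          have hr2 : (2 : ℝ) ≤ r := by exact_mod_cast hr
          have hfx : f M = x + δ := by
            rw [hf, hx, hδ]
            field_simp
            ring
          have hδ0 : 0 ≤ δ := div_nonneg (by linarith) (by linarith)
          have hδ1 : δ ≤ 1 := by
            rw [hδ, div_le_one (by linarith)]
            linarith
          rw [hfx]
          nlinarith [sq_nonneg (x - δ)]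
        calc ∑ M, f M ^ 2 ≤ ∑ M : RMatching r n, (2 * (averageSockuence M -
            ((r : ℝ) - 1) * ((r : ℝ) * n + 1) / (2 * ((r : ℝ) + 1))) ^ 2 + 2) :=
              Finset.sum_le_sum fun M _ => h1 M
          _ ≤ 2 * (Fintype.card (RMatching r n) * ((2 * r + 1) * r ^ 2 * n)) +
              Fintype.card (RMatching r n) * 2 := by
            rw [Finset.sum_add_distrib, ← Finset.mul_sum, Finset.sum_const, nsmul_eq_mul,
              Finset.card_univ]
            have := RMatching.sum_sq_averageSockuence_sub_le hr0 hn
            linarith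
          _ ≤ Fintype.card (RMatching r n) * (K * n) := by
            rw [hK]
            nlinarith
      have hint : ∫ M, f M ^ 2 ∂(randomRMatching r n) ≤ K * n := by
        rw [integral_randomRMatching, inv_mul_le_iff₀ hcard]
        exact hsum
      -- Chebyshev: Markov's inequality for `f²` at the level `(ω n √n)²`.
      have hmarkov := mul_meas_ge_le_integral_of_nonneg (μ := randomRMatching r n)
        (f := fun M => f M ^ 2) (ae_of_all _ fun M => sq_nonneg (f M)) Integrable.of_finite
        (ω n ^ 2 * n)
      have hcompl : (randomRMatching r n).real {M | |f M| ≤ ω n * √(n : ℝ)}ᶜ ≤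
          (randomRMatching r n).real {M | ω n ^ 2 * n ≤ f M ^ 2} := by
        refine measureReal_mono fun M hM => ?_
        simp only [Set.mem_compl_iff, Set.mem_ofPred_eq, not_le] at hM ⊢
        have := pow_le_pow_left₀ (by positivity) hM.le 2
        rwa [mul_pow, Real.sq_sqrt hnpos.le, sq_abs] at this
      rw [probReal_compl_eq_one_sub (MeasurableSet.of_discrete)] at hcompl
      have hle : (randomRMatching r n).real {M | ω n ^ 2 * n ≤ f M ^ 2} ≤ K / ω n ^ 2 := by
        rw [le_div_iff₀ (by positivity)]
        refine le_of_mul_le_mul_right ?_ hnpos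
        calc _ = ω n ^ 2 * n * (randomRMatching r n).real {M | ω n ^ 2 * n ≤ f M ^ 2} := by ring
          _ ≤ _ := hmarkov
          _ ≤ K * n := hint
      linarith
    have hlim : Tendsto (fun n => 1 - K / ω n ^ 2) atTop (𝓝 1) := by
      have : Tendsto (fun n => K / ω n ^ 2) atTop (𝓝 0) :=
        ((tendsto_pow_atTop two_ne_zero).comp hω).const_div_atTop K
      simpa using this.const_sub 1
    refine tendsto_of_tendsto_of_tendsto_of_le_of_le' hlim tendsto_const_nhds hlow ?_
    filter_upwards [eventually_ge_atTop 1] with n hn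
    have := isProbabilityMeasure_randomRMatching (n := n) hr0 (by omega)
    exact measureReal_le_one
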